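/- Let $\lambda$ be the Liouville function, and put $a(1)=0$ and $a(n)=\lambda(n)$ for $n\ge 2$. For real $x\ge 1$ and $\alpha>0$ let $$F_x(\alpha)=\sum_{n\le x}\frac{a(n)}{n^{\alpha}}.$$ Let $\xi=(\xi(n))_{n\ge1}\subset\,]1/2,1[$ be a sequence of mean value points for the functions $t\mapsto n^{-t}$ on $[1/2,1]$, that is, $$n^{-1}-n^{-1/2}=-\tfrac12\,\log(n)\,n^{-\xi(n)}\qquad\text{for all } n\ge 1,$$ and let $$L_x(\xi)=\frac12\sum_{n\le x}\frac{a(n)\log n}{n^{\xi(n)}}\qquad (x\ge 1).$$ Suppose that there exists $r>0$ such that $L_x(\xi)\le 1-r$ for all sufficiently large $x$. Then $F_x(1/2)\le 0$ for all sufficiently large $x$; the function $\zeta(2s)/\zeta(s)$ (with value $0$, its limit, at $s=1$) is analytic in the half-plane $\mathrm{Re}(s)>1/2$; and consequently the Riemann hypothesis holds. -/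

import Mathlib

open Filter Topology

noncomputable section

/-- The coefficients `a(1) = 0` and `a(n) = λ(n)` for `n ≥ 2`, with `λ` the Liouville function. -/
def aCoeff (n : ℕ) : ℝ := if n ≤ 1 then 0 else (ArithmeticFunction.liouville n : ℝ)

/-- `F_x(α) = ∑_{1 ≤ n ≤ x} a(n) n^{-α}`. -/
def partialF (x α : ℝ) : ℝ := ∑ n ∈ Finset.Icc 1 ⌊x⌋₊, aCoeff n / (n : ℝ) ^ α

/-- `L_x(ξ) = (1/2) ∑_{1 ≤ n ≤ x} a(n) log(n) n^{-ξ(n)}`. -/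
def partialL (ξ : ℕ → ℝ) (x : ℝ) : ℝ :=
  (1 / 2) * ∑ n ∈ Finset.Icc 1 ⌊x⌋₊, aCoeff n * Real.log n / (n : ℝ) ^ ξ n

/-- `ξ` is a sequence of mean value points in `]α, β[`: for every `n ≥ 1`, `ξ(n)` is a point at
which the mean value theorem for `t ↦ n^{-t}` on `[α, β]` holds. -/
structure IsMeanValueSeq (α β : ℝ) (ξ : ℕ → ℝ) : Prop where
  mem_Ioo : ∀ n : ℕ, 1 ≤ n → ξ n ∈ Set.Ioo α β
  mean_value : ∀ n : ℕ, 1 ≤ n →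
    (n : ℝ) ^ (-β) - (n : ℝ) ^ (-α) = -(β - α) * Real.log n * (n : ℝ) ^ (-ξ n)

/-- Sequences of mean value points exist. -/
theorem exists_isMeanValueSeq {α β : ℝ} (h : α < β) : ∃ ξ : ℕ → ℝ, IsMeanValueSeq α β ξ := by
  have key : ∀ n : ℕ, ∃ c : ℝ, 1 ≤ n → c ∈ Set.Ioo α β ∧
      (n : ℝ) ^ (-β) - (n : ℝ) ^ (-α) = -(β - α) * Real.log n * (n : ℝ) ^ (-c) := by
    intro n
    by_cases hn : 1 ≤ n
    · have hn0 : (0 : ℝ) < n := by exact_mod_cast hn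
      have hd : ∀ t : ℝ, HasDerivAt (fun t : ℝ => (n : ℝ) ^ (-t))
          (-(Real.log n * (n : ℝ) ^ (-t))) t := by
        intro t
        have := (hasDerivAt_neg t).const_rpow hn0
        convert this using 1
        ring
      obtain ⟨c, hc, e⟩ := exists_hasDerivAt_eq_slope (fun t : ℝ => (n : ℝ) ^ (-t))
        (fun t => -(Real.log n * (n : ℝ) ^ (-t))) h
        (fun t _ => (hd t).continuousAt.continuousWithinAt) (fun t _ => hd t)
      refine ⟨c, fun _ => ⟨hc, ?_⟩⟩
      rw [eq_div_iff (sub_pos.2 h).ne'] at e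
      linarith
    · exact ⟨0, fun h => absurd h hn⟩
  choose ξ hξ using key
  exact ⟨ξ, fun n hn => (hξ n hn).1, fun n hn => (hξ n hn).2⟩

/-- The function `ζ(2s)/ζ(s)`, with its value at `s = 1`, the pole of `ζ`, being the limit `0`. -/
def zetaRatio : ℂ → ℂ :=
  Function.update (fun s : ℂ => riemannZeta (2 * s) / riemannZeta s) 1 0

/-- The value `0` at the pole `s = 1` of `ζ` is the limit of `ζ(2s)/ζ(s)` there. -/
theorem tendsto_zeta_ratio_one :
    Tendsto (fun s : ℂ => riemannZeta (2 * s) / riemannZeta s) (𝓝[≠] 1) (𝓝 0) := by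
  have h1 : Tendsto (fun s : ℂ => riemannZeta (2 * s)) (𝓝[≠] 1) (𝓝 (riemannZeta (2 * 1))) := by
    have h2 : ContinuousAt riemannZeta (2 * 1 : ℂ) :=
      (differentiableAt_riemannZeta (by norm_num)).continuousAt
    have h3 : Tendsto (fun s : ℂ => 2 * s) (𝓝[≠] 1) (𝓝 (2 * 1)) :=
      ((continuous_const.mul continuous_id).tendsto 1).mono_left nhdsWithin_le_nhds
    exact h2.tendsto.comp h3
  have h4 : Tendsto (fun s : ℂ => s - 1) (𝓝[≠] 1) (𝓝 0) := by
    have := ((continuous_id.sub continuous_const).tendsto (1 : ℂ)).mono_left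
      (nhdsWithin_le_nhds (s := {1}ᶜ)) (f := fun s : ℂ => s - 1)
    simpa using this
  have h5 := (h1.mul h4).div riemannZeta_residue_one one_ne_zero
  simp only [mul_zero, zero_div] at h5
  refine h5.congr' ?_
  filter_upwards [self_mem_nhdsWithin] with s hs
  have : s - 1 ≠ 0 := sub_ne_zero.2 hs
  rw [Pi.div_apply, mul_comm (riemannZeta (2 * s)), mul_div_mul_left _ _ this]

end

/-! Write `S(t) = ∑_{n ≤ t} λ(n) n^{-1/2}`. The mean value identity gives `F_x(1/2) = F_x(1) +
L_x(ξ)`, and `∑_{n ≤ x} λ(n)/n ≤ 2`, so the hypothesis bounds `S` above by some constant `C`. Since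
`C - S ≥ 0`, Landau's lemma applies to `s ∫_1^∞ (C - S(t)) t^{-s-1} dt = C - ζ(2s+1)/ζ(s+1/2)`. The
right side has no singularity at real `s > 0`, because `(s-1)ζ(s)` has no positive real zero. The
integral therefore converges for `Re s > 0`, which excludes zeros of `ζ` in `Re > 1/2`; the
functional equation then gives the Riemann hypothesis. At `s = 1/2` the pole of `ζ(s+1/2)` makes the
quotient vanish, so `∫_1^∞ S(t) t^{-3/2} dt = 0`. Partial summation and `S ≤ C` turn this into
`limsup ∑_{n ≤ x} λ(n)/n ≤ 0`. Hence eventually `F_x(1) ≤ r - 1`, and `F_x(1/2) ≤ 0`. The transforms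
are handled as moment generating functions of `log`. -/

/-! ### The Liouville function and squares -/

/-- The indicator function of the nonzero squares, as an arithmetic function. -/
def squareIndicator : ArithmeticFunction ℤ :=
  ⟨fun n => if n ≠ 0 ∧ IsSquare n then 1 else 0, by simp⟩

theorem squareIndicator_apply (n : ℕ) :
    squareIndicator n = if n ≠ 0 ∧ IsSquare n then 1 else 0 := rfl

theorem Nat.Coprime.isSquare_mul_iff {m n : ℕ} (h : m.Coprime n) :
    IsSquare (m * n) ↔ IsSquare m ∧ IsSquare n := by
  refine ⟨fun ⟨k, hk⟩ => ?_, fun ⟨h1, h2⟩ => h1.mul h2⟩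
  have hk2 : m * n = k ^ 2 := by rw [hk, sq]
  refine ⟨?_, ?_⟩
  · obtain ⟨d, hd⟩ := exists_eq_pow_of_mul_eq_pow (Nat.isUnit_iff.2 h) hk2
    exact ⟨d, by rw [hd, sq]⟩
  · obtain ⟨d, hd⟩ := exists_eq_pow_of_mul_eq_pow (a := n) (b := m) (Nat.isUnit_iff.2 h.symm)
      (by rw [mul_comm, hk2])
    exact ⟨d, by rw [hd, sq]⟩

theorem isMultiplicative_squareIndicator : squareIndicator.IsMultiplicative := by
  rw [ArithmeticFunction.IsMultiplicative.iff_ne_zero]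
  refine ⟨by simp [squareIndicator_apply], fun {m n} hm hn h => ?_⟩
  simp only [squareIndicator_apply, h.isSquare_mul_iff]
  by_cases h1 : IsSquare m <;> by_cases h2 : IsSquare n <;> simp [hm, hn, h1, h2]

theorem Nat.Prime.isSquare_pow_iff {p : ℕ} (hp : p.Prime) (k : ℕ) :
    IsSquare (p ^ k) ↔ Even k := by
  refine ⟨fun ⟨d, hd⟩ => ?_, fun h => h.isSquare_pow p⟩
  have hd0 : d ≠ 0 := by
    rintro rfl
    exact pow_ne_zero k hp.ne_zero (by simpa using hd)
  have := congrArg (fun n => n.factorization p) hd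
  simp only [Nat.factorization_mul hd0 hd0, hp.factorization_pow] at this
  exact ⟨d.factorization p, by simpa using this⟩

/-- Both sides are multiplicative; at `p ^ k` the left side is the alternating sum of `(-1) ^ i`
over `i ≤ k`, which is 1 or 0 according to the parity of `k`. -/
theorem liouville_mul_zeta :
    ArithmeticFunction.liouville * (ArithmeticFunction.zeta : ArithmeticFunction ℤ)
      = squareIndicator := by
  rw [ArithmeticFunction.IsMultiplicative.eq_iff_eq_on_prime_powers _
    (ArithmeticFunction.isMultiplicative_liouville.mul
      ArithmeticFunction.isMultiplicative_zeta.natCast) _ isMultiplicative_squareIndicator]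
  intro p k hp
  rw [ArithmeticFunction.coe_mul_zeta_apply, Nat.sum_divisors_prime_pow hp, squareIndicator_apply]
  have h1 : ∀ i, ArithmeticFunction.liouville (p ^ i) = (-1) ^ i := fun i => by
    rw [ArithmeticFunction.liouville_apply (pow_ne_zero i hp.ne_zero),
      ArithmeticFunction.cardFactors_apply_prime_pow hp]
  simp only [h1, hp.isSquare_pow_iff, ne_eq, pow_ne_zero k hp.ne_zero, not_false_eq_true, true_and]
  rw [neg_one_geom_sum]
  simp only [Nat.even_add_one]
  by_cases h : Even k <;> simp [h]

theorem abs_liouville_le_one (n : ℕ) : |(ArithmeticFunction.liouville n : ℝ)| ≤ 1 := by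
  rcases eq_or_ne n 0 with rfl | hn
  · simp
  · simp [ArithmeticFunction.liouville_apply hn]

/-- The partial sums of `∑ λ(n)/n` are bounded. -/
theorem sum_liouville_div_le_two (N : ℕ) :
    ∑ n ∈ Finset.Icc 1 N, (ArithmeticFunction.liouville n : ℝ) / n ≤ 2 := by
  rcases Nat.eq_zero_or_pos N with rfl | hN
  · simp
  have hN' : (0 : ℝ) < N := by exact_mod_cast hN
  -- The left side counts the squares up to `N`.
  have h1 : ∑ n ∈ Finset.Icc 1 N, (ArithmeticFunction.liouville n : ℝ) * (N / n : ℕ) ≤ N := by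
    have h2 := ArithmeticFunction.sum_Ioc_mul_zeta_eq_sum ArithmeticFunction.liouville N
    rw [liouville_mul_zeta] at h2
    have h3 : ∑ n ∈ Finset.Ioc 0 N, squareIndicator n ≤ N := by
      calc ∑ n ∈ Finset.Ioc 0 N, squareIndicator n ≤ ∑ n ∈ Finset.Ioc 0 N, 1 :=
            Finset.sum_le_sum fun n _ => by rw [squareIndicator_apply]; split_ifs <;> norm_num
        _ = N := by simp
    rw [h2, ← Finset.Icc_add_one_left_eq_Ioc] at h3
    simpa only [Int.cast_sum, Int.cast_mul, Int.cast_natCast, zero_add] using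
      (Int.cast_le (R := ℝ)).2 h3
  -- Dropping the floor costs at most 1 per term, hence `N` in total; this gives `N ∑ λ(n)/n ≤ 2N`.
  have h4 : ∀ n ∈ Finset.Icc 1 N, (ArithmeticFunction.liouville n : ℝ) / n * N
      ≤ ArithmeticFunction.liouville n * (N / n : ℕ) + 1 := by
    intro n hn
    have hn0 : (0 : ℝ) < n := by exact_mod_cast (Finset.mem_Icc.1 hn).1
    have h5 : ((N / n : ℕ) : ℝ) ≤ N / n := Nat.cast_div_le
    have h6 : (N : ℝ) / n < (N / n : ℕ) + 1 := by
      rw [← Nat.floor_div_eq_div (K := ℝ)]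
      exact Nat.lt_floor_add_one _
    have h7 := abs_le.1 (abs_liouville_le_one n)
    have h8 : (ArithmeticFunction.liouville n : ℝ) / n * N
        = ArithmeticFunction.liouville n * (N / n) := by ring
    rw [h8]
    nlinarith
  have h9 := Finset.sum_le_sum h4
  rw [← Finset.sum_mul, Finset.sum_add_distrib] at h9
  simp only [Finset.sum_const, Nat.card_Icc, add_tsub_cancel_right, nsmul_eq_mul, mul_one] at h9
  nlinarith

theorem lseriesSummable_liouville {s : ℂ} (hs : 1 < s.re) :
    LSeriesSummable (fun n => (ArithmeticFunction.liouville n : ℂ)) s := by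
  refine LSeriesSummable_of_bounded_of_one_lt_re (m := 1) (fun n _ => ?_) hs
  have := abs_liouville_le_one n
  rw [Complex.norm_intCast]
  exact_mod_cast this

theorem LSeries_squareIndicator {s : ℂ} (hs : 1 < s.re) :
    LSeries (fun n => (squareIndicator n : ℂ)) s = riemannZeta (2 * s) := by
  have h2 : 1 < (2 * s).re := by simp; linarith
  rw [zeta_eq_tsum_one_div_nat_add_one_cpow h2, LSeries]
  have hinj : Function.Injective (fun m : ℕ => (m + 1) ^ 2) := fun a b h => by
    simpa using h
  rw [← hinj.tsum_eq]
  · refine tsum_congr fun m => ?_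
    rw [LSeries.term_of_ne_zero (by positivity), squareIndicator_apply,
      if_pos ⟨by positivity, ⟨m + 1, sq _⟩⟩]
    rw [Nat.cast_pow, ← Complex.natCast_cpow_natCast_mul]
    norm_num
  · intro n hn
    rw [Function.mem_support] at hn
    have hn0 : n ≠ 0 := by rintro rfl; simp at hn
    rw [LSeries.term_of_ne_zero hn0, squareIndicator_apply] at hn
    by_cases h : IsSquare n
    · obtain ⟨k, hk⟩ := h
      have : k ≠ 0 := by rintro rfl; simp at hk; exact hn0 hk
      obtain ⟨m, rfl⟩ := Nat.exists_eq_succ_of_ne_zero this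
      exact ⟨m, by simp [hk, sq]⟩
    · simp [h] at hn

theorem LSeries_liouville_mul_riemannZeta {s : ℂ} (hs : 1 < s.re) :
    LSeries (fun n => (ArithmeticFunction.liouville n : ℂ)) s * riemannZeta s
      = riemannZeta (2 * s) := by
  rw [← ArithmeticFunction.LSeries_zeta_eq_riemannZeta hs, ← LSeries_squareIndicator hs]
  have h := ArithmeticFunction.LSeries_mul'
    (f := (ArithmeticFunction.liouville : ArithmeticFunction ℂ))
    (g := (ArithmeticFunction.zeta : ArithmeticFunction ℂ)) (s := s)
    (by simpa using lseriesSummable_liouville hs)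
    (by simpa using ArithmeticFunction.LSeriesSummable_zeta_iff.2 hs)
  have h2 : (ArithmeticFunction.liouville : ArithmeticFunction ℂ)
      * (ArithmeticFunction.zeta : ArithmeticFunction ℂ)
      = (squareIndicator : ArithmeticFunction ℂ) := by
    rw [← liouville_mul_zeta]
    ext n
    simp [ArithmeticFunction.mul_apply]
  rw [h2] at h
  simpa using h.symm

/-! ### Landau's lemma for moment generating functions -/

section Landau

open MeasureTheory ProbabilityTheory

variable {Ω : Type*} {mΩ : MeasurableSpace Ω} {X : Ω → ℝ} {μ : Measure Ω}

/-- If the Taylor series of the moment generating function of a nonnegative function at an interior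
point `t` of its domain converges at `t + h`, then `t + h` belongs to the domain. -/
theorem mem_integrableExpSet_of_summable (hXm : AEMeasurable X μ) (hX : 0 ≤ᵐ[μ] X) {t h : ℝ}
    (ht : t ∈ interior (integrableExpSet X μ)) (hh : 0 ≤ h)
    (hs : Summable fun n : ℕ => (n.factorial : ℝ)⁻¹ * h ^ n
      * ∫ ω, X ω ^ n * Real.exp (t * X ω) ∂μ) :
    t + h ∈ integrableExpSet X μ := by
  have hint : ∀ n : ℕ, Integrable (fun ω => X ω ^ n * Real.exp (t * X ω)) μ :=
    fun n => integrable_pow_mul_exp_of_mem_interior_integrableExpSet ht n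
  have hm : AEMeasurable (fun ω => Real.exp ((t + h) * X ω)) μ :=
    Real.measurable_exp.comp_aemeasurable (hXm.const_mul _)
  refine ⟨hm.aestronglyMeasurable, ?_⟩
  rw [hasFiniteIntegral_iff_ofReal (Eventually.of_forall fun ω => (Real.exp_pos _).le)]
  -- Expand `exp (h X)` in its power series; all terms are nonnegative, so sum and integral may be
  -- exchanged without knowing integrability at `t + h`.
  have h1 : ∀ᵐ ω ∂μ, ENNReal.ofReal (Real.exp ((t + h) * X ω))
      = ∑' n : ℕ, ENNReal.ofReal
        ((n.factorial : ℝ)⁻¹ * h ^ n * (X ω ^ n * Real.exp (t * X ω))) := by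
    filter_upwards [hX] with ω hω
    have hω' : 0 ≤ X ω := hω
    have e : HasSum (fun n : ℕ => (n.factorial : ℝ)⁻¹ * h ^ n * (X ω ^ n * Real.exp (t * X ω)))
        (Real.exp ((t + h) * X ω)) := by
      have := (NormedSpace.expSeries_div_hasSum_exp (h * X ω)).mul_right (Real.exp (t * X ω))
      rw [← Real.exp_eq_exp_ℝ, ← Real.exp_add] at this
      rw [show (t + h) * X ω = h * X ω + t * X ω by ring]
      refine this.congr_fun fun n => ?_
      rw [mul_pow]; ring
    rw [← ENNReal.ofReal_tsum_of_nonneg (fun n => by positivity) e.summable, e.tsum_eq]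
  rw [lintegral_congr_ae h1, lintegral_tsum
    fun n => (((hint n).1.aemeasurable).const_mul _).ennreal_ofReal]
  have h2 : ∀ n : ℕ, ∫⁻ ω, ENNReal.ofReal
      ((n.factorial : ℝ)⁻¹ * h ^ n * (X ω ^ n * Real.exp (t * X ω))) ∂μ
      = ENNReal.ofReal ((n.factorial : ℝ)⁻¹ * h ^ n * ∫ ω, X ω ^ n * Real.exp (t * X ω) ∂μ) := by
    intro n
    rw [← integral_const_mul, ofReal_integral_eq_lintegral_ofReal ((hint n).const_mul _)]
    filter_upwards [hX] with ω hω
    have hω' : 0 ≤ X ω := hω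
    simp only [Pi.zero_apply]
    positivity
  simp_rw [h2]
  exact hs.tsum_ofReal_lt_top

/-- **Landau's lemma**: if `X` is nonnegative, its moment generating function is finite on
`(-∞, t₀)` and has an analytic continuation to a neighbourhood of `t₀`, then it is finite beyond
`t₀`. -/
theorem exists_gt_mem_integrableExpSet (hXm : AEMeasurable X μ) (hX : 0 ≤ᵐ[μ] X) {t₀ : ℝ}
    (hI : Set.Iio t₀ ⊆ integrableExpSet X μ) {f : ℂ → ℂ} (hf : AnalyticAt ℂ f t₀)
    (heq : ∀ᶠ z in 𝓝 (t₀ : ℂ), z.re < t₀ → f z = complexMGF X μ z) :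
    ∃ t, t₀ < t ∧ t ∈ integrableExpSet X μ := by
  obtain ⟨δ, hδ, hball⟩ := Metric.eventually_nhds_iff_ball.1
    (hf.eventually_analyticAt.and heq)
  -- The disc of radius `δ/2` about `t₁` stays in the disc of analyticity, and `h = 3δ/8` lies
  -- between `δ/4` and `δ/2`, so `t₁ + h = t₀ + δ/8` is inside it and beyond `t₀`.
  set t₁ : ℝ := t₀ - δ / 4 with ht₁
  have hint : t₁ ∈ interior (integrableExpSet X μ) :=
    mem_interior.2 ⟨_, hI, isOpen_Iio, by simp only [Set.mem_Iio, ht₁]; linarith⟩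
  have hdist : dist (t₁ : ℂ) t₀ = δ / 4 := by
    rw [Complex.dist_eq, ← Complex.ofReal_sub, Complex.norm_real, ht₁]
    rw [show t₀ - δ / 4 - t₀ = -(δ / 4) by ring, norm_neg, Real.norm_of_nonneg (by positivity)]
  have hsub : Metric.ball (t₁ : ℂ) (δ / 2) ⊆ Metric.ball (t₀ : ℂ) δ :=
    Metric.ball_subset_ball' (by rw [hdist]; linarith)
  have hd : DifferentiableOn ℂ f (Metric.ball (t₁ : ℂ) (δ / 2)) := fun z hz =>
    (hball z (hsub hz)).1.differentiableAt.differentiableWithinAt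
  set h : ℝ := 3 * δ / 8 with hh
  have hhm : ((t₁ + h : ℝ) : ℂ) ∈ Metric.ball (t₁ : ℂ) (δ / 2) := by
    rw [Metric.mem_ball, Complex.dist_eq, ← Complex.ofReal_sub, Complex.norm_real,
      add_sub_cancel_left, Real.norm_of_nonneg (by positivity)]
    linarith
  have hsum := Complex.hasSum_taylorSeries_on_ball hd hhm
  refine ⟨t₁ + h, by rw [ht₁, hh]; linarith,
    mem_integrableExpSet_of_summable hXm hX hint (by positivity) ?_⟩
  -- Near `t₁` the continuation is the transform itself, so its Taylor coefficients there are the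
  -- exponential moments.
  have hev : f =ᶠ[𝓝 (t₁ : ℂ)] complexMGF X μ := by
    have h1 : ∀ᶠ z in 𝓝 (t₁ : ℂ), z ∈ Metric.ball (t₀ : ℂ) δ :=
      Metric.isOpen_ball.mem_nhds (by rw [Metric.mem_ball, hdist]; linarith)
    have h2 : ∀ᶠ z : ℂ in 𝓝 (t₁ : ℂ), z.re < t₀ :=
      Complex.continuous_re.continuousAt.eventually_lt continuousAt_const
        (by simp only [Complex.ofReal_re, ht₁]; linarith)
    filter_upwards [h1, h2] with z hz1 hz2 using (hball z hz1).2 hz2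
  rw [← Complex.summable_ofReal]
  refine (summable_congr fun n => ?_).2 hsum.summable
  rw [hev.iteratedDeriv_eq n, iteratedDeriv_complexMGF (by simpa using hint) n]
  have e : ∫ ω, (X ω : ℂ) ^ n * Complex.exp (t₁ * X ω) ∂μ
      = ((∫ ω, X ω ^ n * Real.exp (t₁ * X ω) ∂μ : ℝ) : ℂ) := by
    rw [← integral_complex_ofReal]
    congr 1
    ext ω
    push_cast
    rfl
  rw [e]
  push_cast
  simp [smul_eq_mul, mul_assoc]

end Landau

/-! ### Mellin-type integrals over `(1, ∞)` as moment generating functions -/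

section PowerMeasure

open MeasureTheory ProbabilityTheory

/-- The measure `g(t) dt/t` on `(1, ∞)`. -/
noncomputable def powerMeasure (g : ℝ → ℝ) : Measure ℝ :=
  (volume.restrict (Set.Ioi 1)).withDensity fun t => ENNReal.ofReal (g t / t)

variable {g : ℝ → ℝ}

theorem measurable_ofReal_div_id (hm : Measurable g) :
    Measurable fun t => ENNReal.ofReal (g t / t) :=
  (hm.div measurable_id).ennreal_ofReal

theorem log_nonneg_ae_powerMeasure (g : ℝ → ℝ) : 0 ≤ᵐ[powerMeasure g] Real.log := by
  refine (withDensity_absolutelyContinuous _ _).ae_le ?_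
  filter_upwards [ae_restrict_mem measurableSet_Ioi] with t ht using Real.log_nonneg (le_of_lt ht)

/-- Through `t = exp (log t)`, the moment generating function of `log` at `-s` under `g(t) dt/t` is
the Mellin integral of `g(t) t^{-s-1}`. -/
theorem rpow_neg_add_one_eq {t : ℝ} (ht : 0 < t) (s : ℝ) :
    t ^ (-(s + 1)) = Real.exp (-s * Real.log t) / t := by
  rw [Real.rpow_def_of_pos ht, show Real.log t * -(s + 1) = -s * Real.log t - Real.log t by ring,
    Real.exp_sub, Real.exp_log ht]

theorem cpow_neg_add_one_eq {t : ℝ} (ht : 0 < t) (s : ℂ) :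
    (t : ℂ) ^ (-(s + 1)) = Complex.exp (-s * Real.log t) / t := by
  have h : (t : ℂ) ≠ 0 := by exact_mod_cast ht.ne'
  rw [Complex.cpow_def_of_ne_zero h, ← Complex.ofReal_log ht.le,
    show (Real.log t : ℂ) * -(s + 1) = -s * Real.log t - Real.log t by ring,
    Complex.exp_sub, Complex.ofReal_log ht.le, Complex.exp_log h]

theorem neg_mem_integrableExpSet_powerMeasure (hm : Measurable g) (hg : ∀ t, 1 < t → 0 ≤ g t)
    (s : ℝ) : -s ∈ integrableExpSet Real.log (powerMeasure g) ↔
      IntegrableOn (fun t => g t * t ^ (-(s + 1))) (Set.Ioi 1) := by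
  rw [integrableExpSet, Set.mem_ofPred_eq, powerMeasure,
    integrable_withDensity_iff_integrable_smul' (measurable_ofReal_div_id hm)
      (Eventually.of_forall fun _ => ENNReal.ofReal_lt_top)]
  refine integrable_congr ?_
  filter_upwards [ae_restrict_mem measurableSet_Ioi] with t ht
  have ht0 : 0 < t := zero_lt_one.trans ht
  rw [ENNReal.toReal_ofReal (div_nonneg (hg t ht) ht0.le), rpow_neg_add_one_eq ht0, smul_eq_mul]
  ring

theorem complexMGF_log_powerMeasure (hm : Measurable g) (hg : ∀ t, 1 < t → 0 ≤ g t) (s : ℂ) :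
    complexMGF Real.log (powerMeasure g) (-s)
      = ∫ t in Set.Ioi (1 : ℝ), (g t : ℂ) * (t : ℂ) ^ (-(s + 1)) := by
  rw [complexMGF, powerMeasure, integral_withDensity_eq_integral_toReal_smul
    (measurable_ofReal_div_id hm) (Eventually.of_forall fun _ => ENNReal.ofReal_lt_top)]
  refine setIntegral_congr_fun measurableSet_Ioi fun t ht => ?_
  have ht0 : 0 < t := zero_lt_one.trans ht
  rw [ENNReal.toReal_ofReal (div_nonneg (hg t ht) ht0.le), cpow_neg_add_one_eq ht0,
    Complex.real_smul]
  push_cast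
  ring

theorem integrableOn_mul_rpow_of_le (hm : Measurable g) (hg : ∀ t, 1 < t → 0 ≤ g t) {C a s : ℝ}
    (hle : ∀ t, 1 < t → g t ≤ C * t ^ a) (hs : a < s) :
    IntegrableOn (fun t => g t * t ^ (-(s + 1))) (Set.Ioi 1) := by
  have h : IntegrableOn (fun t : ℝ => C * t ^ (a - (s + 1))) (Set.Ioi 1) :=
    (integrableOn_Ioi_rpow_of_lt (by linarith) zero_lt_one).const_mul C
  refine h.mono' (hm.mul (by fun_prop)).aestronglyMeasurable ?_
  filter_upwards [ae_restrict_mem measurableSet_Ioi] with t ht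
  have ht0 : 0 < t := zero_lt_one.trans ht
  rw [Real.norm_of_nonneg (mul_nonneg (hg t ht) (by positivity)), sub_eq_add_neg,
    Real.rpow_add ht0, ← mul_assoc]
  exact mul_le_mul_of_nonneg_right (hle t ht) (by positivity)

/-- If `(-∞, -σ)` is contained in the domain, then the transform is analytic on `Re s > σ`. -/
theorem analyticOnNhd_complexMGF_neg {Ω : Type*} {mΩ : MeasurableSpace Ω} {X : Ω → ℝ}
    {μ : Measure Ω} {σ : ℝ} (h : Set.Iio (-σ) ⊆ integrableExpSet X μ) :
    AnalyticOnNhd ℂ (fun s => complexMGF X μ (-s)) {s : ℂ | σ < s.re} := by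
  intro s hs
  have h1 : (-s).re ∈ interior (integrableExpSet X μ) :=
    mem_interior.2 ⟨_, h, isOpen_Iio, by simpa using hs⟩
  exact (analyticAt_complexMGF h1).comp_of_eq analyticAt_id.neg rfl

end PowerMeasure

/-! ### The zeta function on the interval `(0, 1)` -/

section ZetaInterval

open MeasureTheory ProbabilityTheory

theorem isPreconnected_halfPlane (σ : ℝ) : IsPreconnected {s : ℂ | σ < s.re} :=
  (convex_halfSpace_re_gt σ).isPreconnected

theorem isOpen_halfPlane (σ : ℝ) : IsOpen {s : ℂ | σ < s.re} :=
  isOpen_lt continuous_const Complex.continuous_re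

theorem riemannZeta₁_eq_mul {s : ℂ} (hs : s ≠ 1) :
    riemannZeta₁ s = (s - 1) * riemannZeta s := by
  rw [riemannZeta_eq_inv_sub_mul hs, mul_inv_cancel_left₀ (sub_ne_zero.2 hs)]

theorem Iio_zero_subset_integrableExpSet_fract :
    Set.Iio (-(0 : ℝ)) ⊆ integrableExpSet Real.log (powerMeasure Int.fract) := by
  intro t ht
  rw [← neg_neg t, neg_mem_integrableExpSet_powerMeasure measurable_fract
    fun t _ => Int.fract_nonneg t]
  refine integrableOn_mul_rpow_of_le measurable_fract (fun t _ => Int.fract_nonneg t)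
    (C := 1) (a := 0) (fun t _ => ?_) (by simpa using ht)
  simpa using (Int.fract_lt_one t).le

/-- Partial summation with `⌊t⌋ = t - {t}`: the term `t` integrates to `s/(s-1)`, and the bounded
remainder has a transform that converges for `Re s > 0`. -/
theorem riemannZeta_eq_integral_fract {s : ℂ} (hs : 1 < s.re) :
    riemannZeta s = s / (s - 1) - s * complexMGF Real.log (powerMeasure Int.fract) (-s) := by
  have hO : (fun n : ℕ => ∑ k ∈ Finset.Icc 1 n, (fun _ : ℕ => (1 : ℝ)) k)
      =O[atTop] fun n : ℕ => (n : ℝ) ^ (1 : ℝ) := by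
    refine Asymptotics.isBigO_of_le _ fun n => ?_
    simp
  have h := LSeries_eq_mul_integral_of_nonneg (fun _ => (1 : ℝ)) zero_le_one hs hO
    fun _ => zero_le_one
  have h1 : LSeries (fun _ => ((1 : ℝ) : ℂ)) s = riemannZeta s := by
    simp only [Complex.ofReal_one]
    exact LSeries_one_eq_riemannZeta hs
  rw [h1] at h
  rw [h, complexMGF_log_powerMeasure measurable_fract fun t _ => Int.fract_nonneg t]
  have hi1 : IntegrableOn (fun t : ℝ => (t : ℂ) ^ (-s)) (Set.Ioi 1) :=
    integrableOn_Ioi_cpow_of_lt (by simpa using hs) zero_lt_one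
  have hi2 : IntegrableOn (fun t : ℝ => ((Int.fract t : ℝ) : ℂ) * (t : ℂ) ^ (-(s + 1)))
      (Set.Ioi 1) := by
    have h2 : IntegrableOn (fun t : ℝ => (t : ℂ) ^ (-(s + 1))) (Set.Ioi 1) :=
      integrableOn_Ioi_cpow_of_lt (by simp; linarith) zero_lt_one
    refine h2.bdd_mul (c := 1) (by fun_prop) (Eventually.of_forall fun t => ?_)
    rw [Complex.norm_real, Real.norm_of_nonneg (Int.fract_nonneg t)]
    exact (Int.fract_lt_one t).le
  have h3 : ∫ t in Set.Ioi (1 : ℝ), (t : ℂ) ^ (-s) = 1 / (s - 1) := by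
    rw [integral_Ioi_cpow_of_lt (by simpa using hs) zero_lt_one]
    simp only [Complex.ofReal_one, Complex.one_cpow]
    rw [show (-s + 1 : ℂ) = -(s - 1) by ring, neg_div_neg_eq]
  have h4 : ∫ t in Set.Ioi (1 : ℝ), (∑ k ∈ Finset.Icc 1 ⌊t⌋₊, ((1 : ℝ) : ℂ)) * (t : ℂ) ^ (-(s + 1))
      = ∫ t in Set.Ioi (1 : ℝ),
        ((t : ℂ) ^ (-s) - ((Int.fract t : ℝ) : ℂ) * (t : ℂ) ^ (-(s + 1))) := by
    refine setIntegral_congr_fun measurableSet_Ioi fun t ht => ?_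
    have ht0 : 0 < t := zero_lt_one.trans ht
    have htc : (t : ℂ) ≠ 0 := by exact_mod_cast ht0.ne'
    have e1 : (t : ℂ) ^ (-s) = t * (t : ℂ) ^ (-(s + 1)) := by
      rw [neg_add, Complex.cpow_add _ _ htc, Complex.cpow_neg_one]
      field_simp
    have e2 : Int.fract t = t - ⌊t⌋₊ := by
      rw [Int.fract, natCast_floor_eq_intCast_floor ht0.le]
    simp only [Finset.sum_const, Nat.card_Icc, add_tsub_cancel_right]
    rw [e1, e2]
    push_cast
    simp only [nsmul_eq_mul]
    ring
  rw [h4, integral_sub hi1 hi2, h3]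
  ring

/-- The factor `s - 1` removes the pole, so the identity theorem carries the formula from `Re s > 1`
to `Re s > 0`. -/
theorem riemannZeta₁_eq_integral_fract {s : ℂ} (hs : 0 < s.re) :
    riemannZeta₁ s
      = s - s * (s - 1) * complexMGF Real.log (powerMeasure Int.fract) (-s) := by
  have h1 : AnalyticOnNhd ℂ riemannZeta₁ {s : ℂ | 0 < s.re} := fun z _ =>
    differentiable_riemannZeta₁.analyticAt z
  have h2 : AnalyticOnNhd ℂ (fun s : ℂ =>
      s - s * (s - 1) * complexMGF Real.log (powerMeasure Int.fract) (-s)) {s : ℂ | 0 < s.re} :=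
    fun z hz => by
      have := analyticOnNhd_complexMGF_neg Iio_zero_subset_integrableExpSet_fract z hz
      fun_prop
  refine h1.eqOn_of_preconnected_of_eventuallyEq h2 (isPreconnected_halfPlane 0) (z₀ := 2)
    (by simp) ?_ hs
  filter_upwards [(isOpen_halfPlane 1).mem_nhds (show (2 : ℂ) ∈ {s : ℂ | 1 < s.re} by simp)]
    with z hz
  have hz1 : z ≠ 1 := by rintro rfl; simp at hz
  rw [riemannZeta₁_eq_mul hz1, riemannZeta_eq_integral_fract hz]
  have := sub_ne_zero.2 hz1
  field_simp

theorem riemannZeta₁_ofReal_ne_zero {σ : ℝ} (hσ : 0 < σ) : riemannZeta₁ σ ≠ 0 := by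
  rcases le_or_gt 1 σ with h | h
  · rcases h.eq_or_lt with rfl | h'
    · simp
    · have h1 : (σ : ℂ) ≠ 1 := by exact_mod_cast h'.ne'
      rw [riemannZeta₁_eq_mul h1]
      exact mul_ne_zero (sub_ne_zero.2 h1) (riemannZeta_ne_zero_of_one_le_re (by simpa using h))
  · rw [riemannZeta₁_eq_integral_fract (by simpa using hσ), ← Complex.ofReal_neg,
      complexMGF_ofReal]
    have h1 : 0 ≤ mgf Real.log (powerMeasure Int.fract) (-σ) := mgf_nonneg
    -- For `0 < σ < 1` this is `σ` plus a nonnegative multiple of an integral of `{t} t^{-σ-1}`.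
    have h2 : 0 < σ - σ * (σ - 1) * mgf Real.log (powerMeasure Int.fract) (-σ) := by
      have : 0 ≤ σ * (1 - σ) * mgf Real.log (powerMeasure Int.fract) (-σ) :=
        mul_nonneg (mul_nonneg hσ.le (by linarith)) h1
      linarith
    exact_mod_cast h2.ne'

end ZetaInterval

/-! ### Partial sums of `∑ λ(n) n^{-1/2}` -/

section LiouvilleSum

open MeasureTheory ProbabilityTheory

/-- The partial sums `∑_{n ≤ t} λ(n) n^{-1/2}`. -/
noncomputable def liouvilleSum (t : ℝ) : ℝ :=
  ∑ n ∈ Finset.Icc 1 ⌊t⌋₊, (ArithmeticFunction.liouville n : ℝ) / (n : ℝ) ^ (1 / 2 : ℝ)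

theorem partialF_eq {x : ℝ} (hx : 1 ≤ x) (α : ℝ) :
    partialF x α
      = ∑ n ∈ Finset.Icc 1 ⌊x⌋₊, (ArithmeticFunction.liouville n : ℝ) / (n : ℝ) ^ α - 1 := by
  have hmem : 1 ∈ Finset.Icc 1 ⌊x⌋₊ := Finset.mem_Icc.2 ⟨le_rfl, Nat.le_floor (by simpa using hx)⟩
  rw [partialF, ← Finset.add_sum_erase _ _ hmem, ← Finset.add_sum_erase _ _ hmem]
  have h : ∑ n ∈ (Finset.Icc 1 ⌊x⌋₊).erase 1, aCoeff n / (n : ℝ) ^ α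
      = ∑ n ∈ (Finset.Icc 1 ⌊x⌋₊).erase 1,
        (ArithmeticFunction.liouville n : ℝ) / (n : ℝ) ^ α := by
    refine Finset.sum_congr rfl fun n hn => ?_
    rw [Finset.mem_erase, Finset.mem_Icc] at hn
    rw [aCoeff, if_neg (by omega)]
  rw [h, aCoeff, if_pos le_rfl, ArithmeticFunction.liouville_apply_one]
  simp

theorem partialF_half_eq_add_partialL {ξ : ℕ → ℝ} (hξ : IsMeanValueSeq (1 / 2) 1 ξ) (x : ℝ) :
    partialF x (1 / 2) = partialF x 1 + partialL ξ x := by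
  rw [partialF, partialF, partialL, Finset.mul_sum, ← Finset.sum_add_distrib]
  refine Finset.sum_congr rfl fun n hn => ?_
  have h := hξ.mean_value n (Finset.mem_Icc.1 hn).1
  rw [Real.rpow_neg n.cast_nonneg, Real.rpow_neg n.cast_nonneg, Real.rpow_neg n.cast_nonneg] at h
  simp only [div_eq_mul_inv] at h ⊢
  linear_combination (-aCoeff n) * h

theorem measurable_liouvilleSum : Measurable liouvilleSum :=
  (measurable_from_nat (f := fun N : ℕ => ∑ n ∈ Finset.Icc 1 N,
    (ArithmeticFunction.liouville n : ℝ) / (n : ℝ) ^ (1 / 2 : ℝ))).comp Nat.measurable_floor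

theorem abs_liouville_div_rpow_le (n : ℕ) :
    |(ArithmeticFunction.liouville n : ℝ) / (n : ℝ) ^ (1 / 2 : ℝ)| ≤ 1 := by
  rcases Nat.eq_zero_or_pos n with rfl | hn
  · simp
  have h1 : (1 : ℝ) ≤ (n : ℝ) ^ (1 / 2 : ℝ) :=
    Real.one_le_rpow (by exact_mod_cast hn) (by norm_num)
  rw [abs_div, abs_of_nonneg (zero_le_one.trans h1)]
  exact div_le_one_of_le₀ ((abs_liouville_le_one n).trans h1) (zero_le_one.trans h1)

theorem abs_liouvilleSum_le {t : ℝ} (ht : 0 ≤ t) : |liouvilleSum t| ≤ t := by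
  calc |liouvilleSum t| ≤ ∑ n ∈ Finset.Icc 1 ⌊t⌋₊,
        |(ArithmeticFunction.liouville n : ℝ) / (n : ℝ) ^ (1 / 2 : ℝ)| :=
      Finset.abs_sum_le_sum_abs _ _
    _ ≤ ∑ n ∈ Finset.Icc 1 ⌊t⌋₊, 1 := Finset.sum_le_sum fun n _ => abs_liouville_div_rpow_le n
    _ = ⌊t⌋₊ := by simp
    _ ≤ t := Nat.floor_le ht

/-- Partial summation for the Dirichlet series of `λ(n) n^{-1/2}`, which is that of `λ` shifted to
`s + 1/2`. -/
theorem mul_integral_liouvilleSum_mul_riemannZeta {s : ℂ} (hs : 1 < s.re) :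
    (s * ∫ t in Set.Ioi (1 : ℝ), (liouvilleSum t : ℂ) * (t : ℂ) ^ (-(s + 1)))
      * riemannZeta (s + 1 / 2) = riemannZeta (2 * s + 1) := by
  set c : ℕ → ℂ := fun n =>
    (((ArithmeticFunction.liouville n : ℝ) / (n : ℝ) ^ (1 / 2 : ℝ) : ℝ) : ℂ) with hc
  have hO : (fun n : ℕ => ∑ k ∈ Finset.Icc 1 n, ‖c k‖) =O[atTop] fun n : ℕ => (n : ℝ) ^ (1 : ℝ) := by
    refine Asymptotics.isBigO_of_le _ fun n => ?_
    rw [Real.norm_of_nonneg (Finset.sum_nonneg fun _ _ => norm_nonneg _), Real.rpow_one,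
      Real.norm_of_nonneg n.cast_nonneg]
    calc ∑ k ∈ Finset.Icc 1 n, ‖c k‖ ≤ ∑ k ∈ Finset.Icc 1 n, 1 :=
          Finset.sum_le_sum fun k _ => by
            rw [hc, Complex.norm_real]; exact abs_liouville_div_rpow_le k
      _ = n := by simp
  have h := LSeries_eq_mul_integral' c zero_le_one hs hO
  have h1 : LSeries c s
      = LSeries (fun n => (ArithmeticFunction.liouville n : ℂ)) (s + 1 / 2) := by
    refine tsum_congr fun n => ?_
    rcases eq_or_ne n 0 with rfl | hn
    · simp
    rw [LSeries.term_of_ne_zero hn, LSeries.term_of_ne_zero hn, add_comm,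
      Complex.cpow_add _ _ (Nat.cast_ne_zero.2 hn), ← div_div, hc]
    simp only
    rw [Complex.ofReal_div, Complex.ofReal_cpow n.cast_nonneg]
    push_cast
    rfl
  have h2 : ∀ t : ℝ, ∑ k ∈ Finset.Icc 1 ⌊t⌋₊, c k = (liouvilleSum t : ℂ) := fun t => by
    rw [liouvilleSum, Complex.ofReal_sum]
  simp only [h2] at h
  have hs2 : 1 < (s + 1 / 2).re := by simp; linarith
  rw [← h, h1, LSeries_liouville_mul_riemannZeta hs2]
  congr 1
  ring

end LiouvilleSum

/-! ### Consequences of an upper bound for the partial sums -/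

section UpperBound

open MeasureTheory ProbabilityTheory

variable {C : ℝ}

/-- The measure `(C - ∑_{n ≤ t} λ(n) n^{-1/2}) dt/t` on `(1, ∞)`. -/
noncomputable def liouvilleMeasure (C : ℝ) : Measure ℝ :=
  powerMeasure fun t => C - liouvilleSum t

theorem measurable_const_sub_liouvilleSum (C : ℝ) : Measurable fun t => C - liouvilleSum t :=
  measurable_const.sub measurable_liouvilleSum

theorem Iio_neg_one_subset_integrableExpSet (hC : ∀ t, 1 < t → 0 ≤ C - liouvilleSum t) :
    Set.Iio (-1 : ℝ) ⊆ integrableExpSet Real.log (liouvilleMeasure C) := by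
  intro u hu
  rw [← neg_neg u, liouvilleMeasure,
    neg_mem_integrableExpSet_powerMeasure (measurable_const_sub_liouvilleSum C) hC]
  refine integrableOn_mul_rpow_of_le (measurable_const_sub_liouvilleSum C) hC
    (C := |C| + 1) (a := 1) (fun t ht => ?_) (by simp only [Set.mem_Iio] at hu; linarith)
  have h1 := (abs_le.1 (abs_liouvilleSum_le (zero_le_one.trans ht.le))).1
  have h2 : C ≤ |C| * t := (le_abs_self C).trans (le_mul_of_one_le_right (abs_nonneg C) ht.le)
  rw [Real.rpow_one]
  linarith

/-- Stated as a product rather than a quotient, so that it can be continued analytically before `ζ`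
is known to be nonzero. -/
theorem sub_mul_complexMGF_mul_riemannZeta₁_of_one_lt
    (hC : ∀ t, 1 < t → 0 ≤ C - liouvilleSum t) {s : ℂ} (hs : 1 < s.re) :
    (C - s * complexMGF Real.log (liouvilleMeasure C) (-s)) * riemannZeta₁ (s + 1 / 2)
      = (s - 1 / 2) * riemannZeta (2 * s + 1) := by
  have hs0 : s ≠ 0 := by rintro rfl; simp at hs; linarith
  have hi1 : IntegrableOn (fun t : ℝ => (C : ℂ) * (t : ℂ) ^ (-(s + 1))) (Set.Ioi 1) :=
    (integrableOn_Ioi_cpow_of_lt (by simp; linarith) zero_lt_one).const_mul _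
  have hi2 : IntegrableOn (fun t : ℝ => (liouvilleSum t : ℂ) * (t : ℂ) ^ (-(s + 1)))
      (Set.Ioi 1) := by
    have h2 : IntegrableOn (fun t : ℝ => (t : ℂ) ^ (-s)) (Set.Ioi 1) :=
      integrableOn_Ioi_cpow_of_lt (by simpa using hs) zero_lt_one
    refine Integrable.mono h2 ?_ ?_
    · exact ((Complex.measurable_ofReal.comp measurable_liouvilleSum).mul
        (by fun_prop)).aestronglyMeasurable
    · filter_upwards [ae_restrict_mem measurableSet_Ioi] with t ht
      have ht0 : 0 < t := zero_lt_one.trans ht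
      rw [norm_mul, Complex.norm_real, Complex.norm_cpow_eq_rpow_re_of_pos ht0,
        Complex.norm_cpow_eq_rpow_re_of_pos ht0]
      calc ‖liouvilleSum t‖ * t ^ (-(s + 1)).re ≤ t * t ^ (-(s + 1)).re :=
            mul_le_mul_of_nonneg_right (abs_liouvilleSum_le ht0.le) (by positivity)
        _ = t ^ (-s).re := by
            rw [← Real.rpow_one_add' ht0.le (by simp; linarith)]
            congr 1
            simp
  have h1 : ∫ t in Set.Ioi (1 : ℝ), (C : ℂ) * (t : ℂ) ^ (-(s + 1)) = C / s := by
    rw [integral_const_mul, integral_Ioi_cpow_of_lt (by simp; linarith) zero_lt_one]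
    simp only [Complex.ofReal_one, Complex.one_cpow]
    rw [show (-(s + 1) + 1 : ℂ) = -s by ring, neg_div_neg_eq, mul_one_div]
  have h2 : complexMGF Real.log (liouvilleMeasure C) (-s)
      = C / s - ∫ t in Set.Ioi (1 : ℝ), (liouvilleSum t : ℂ) * (t : ℂ) ^ (-(s + 1)) := by
    rw [liouvilleMeasure,
      complexMGF_log_powerMeasure (measurable_const_sub_liouvilleSum C) hC, ← h1,
      ← integral_sub hi1 hi2]
    refine setIntegral_congr_fun measurableSet_Ioi fun t _ => ?_
    push_cast
    ring
  have hw : s + 1 / 2 ≠ 1 := by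
    intro h
    have := congrArg Complex.re h
    simp at this
    linarith
  rw [riemannZeta₁_eq_mul hw, ← mul_integral_liouvilleSum_mul_riemannZeta hs, h2, mul_sub,
    mul_div_cancel₀ _ hs0]
  ring

theorem analyticAt_riemannZeta {s : ℂ} (hs : s ≠ 1) : AnalyticAt ℂ riemannZeta s :=
  differentiableOn_riemannZeta.analyticAt (isOpen_compl_singleton.mem_nhds hs)

theorem two_mul_add_one_ne_one {s : ℂ} (hs : 0 < s.re) : 2 * s + 1 ≠ 1 := by
  intro h
  have := congrArg Complex.re h
  simp at this
  linarith

theorem sub_mul_complexMGF_mul_riemannZeta₁ (hC : ∀ t, 1 < t → 0 ≤ C - liouvilleSum t) {σ : ℝ}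
    (hσ : 0 ≤ σ) (h : Set.Iio (-σ) ⊆ integrableExpSet Real.log (liouvilleMeasure C))
    {s : ℂ} (hs : σ < s.re) :
    (C - s * complexMGF Real.log (liouvilleMeasure C) (-s)) * riemannZeta₁ (s + 1 / 2)
      = (s - 1 / 2) * riemannZeta (2 * s + 1) := by
  have h1 : AnalyticOnNhd ℂ (fun s : ℂ => (C - s * complexMGF Real.log (liouvilleMeasure C) (-s))
      * riemannZeta₁ (s + 1 / 2)) {s : ℂ | σ < s.re} := fun z hz => by
    have e1 := analyticOnNhd_complexMGF_neg h z hz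
    have e2 : AnalyticAt ℂ (fun s : ℂ => riemannZeta₁ (s + 1 / 2)) z :=
      (differentiable_riemannZeta₁.comp (differentiable_id.add_const _)).analyticAt z
    fun_prop
  have h2 : AnalyticOnNhd ℂ (fun s : ℂ => (s - 1 / 2) * riemannZeta (2 * s + 1))
      {s : ℂ | σ < s.re} := fun z hz => by
    have e1 : AnalyticAt ℂ (fun s : ℂ => riemannZeta (2 * s + 1)) z :=
      (analyticAt_riemannZeta (two_mul_add_one_ne_one (hσ.trans_lt hz))).comp_of_eq
        (by fun_prop) rfl
    fun_prop
  have hm : ((σ + 2 : ℝ) : ℂ) ∈ {s : ℂ | 1 < s.re} := by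
    simp only [Set.mem_ofPred_eq, Complex.ofReal_re]; linarith
  refine h1.eqOn_of_preconnected_of_eventuallyEq h2 (isPreconnected_halfPlane σ)
    (z₀ := ((σ + 2 : ℝ) : ℂ)) (by simp) ?_ hs
  filter_upwards [(isOpen_halfPlane 1).mem_nhds hm] with z hz
  exact sub_mul_complexMGF_mul_riemannZeta₁_of_one_lt hC hz

/-- Otherwise let `t₀ < 0` be the infimum of the negative points outside the domain. Dividing the
product identity by `riemannZeta₁`, which is nonzero on the positive reals, continues the transform
analytically past `t₀`, contrary to Landau's lemma. -/
theorem Iio_zero_subset_integrableExpSet (hC : ∀ t, 1 < t → 0 ≤ C - liouvilleSum t) :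
    Set.Iio (-(0 : ℝ)) ⊆ integrableExpSet Real.log (liouvilleMeasure C) := by
  rw [neg_zero]
  by_contra hcon
  set I := integrableExpSet Real.log (liouvilleMeasure C) with hI
  have hone := Iio_neg_one_subset_integrableExpSet hC
  set B : Set ℝ := Set.Iio 0 \ I with hB
  have hne : B.Nonempty := Set.sdiff_nonempty.2 hcon
  have hbdd : BddBelow B := ⟨-1, fun u hu => not_lt.1 fun hu' => hu.2 (hone hu')⟩
  set t₀ := sInf B with ht₀
  have ht₀neg : t₀ < 0 := by
    obtain ⟨u, hu⟩ := hne
    exact (csInf_le hbdd hu).trans_lt hu.1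
  have hlt : Set.Iio t₀ ⊆ I := fun u hu => by
    by_contra hu'
    exact notMem_of_lt_csInf hu hbdd ⟨lt_trans hu ht₀neg, hu'⟩
  have ht₀re : 0 < (-(t₀ : ℂ)).re := by simpa using ht₀neg
  have hz₁ : riemannZeta₁ (-(t₀ : ℂ) + 1 / 2) ≠ 0 := by
    have := riemannZeta₁_ofReal_ne_zero (σ := -t₀ + 1 / 2) (by linarith)
    push_cast at this
    exact this
  have ht₀0 : (t₀ : ℂ) ≠ 0 := by exact_mod_cast ht₀neg.ne
  have ha₁ : AnalyticAt ℂ (fun z : ℂ => riemannZeta₁ (-z + 1 / 2)) t₀ :=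
    (differentiable_riemannZeta₁.comp (differentiable_id.neg.add_const _)).analyticAt _
  have ha₂ : AnalyticAt ℂ (fun z : ℂ => riemannZeta (2 * (-z) + 1)) t₀ :=
    (analyticAt_riemannZeta (two_mul_add_one_ne_one ht₀re)).comp_of_eq (by fun_prop) rfl
  have hf : AnalyticAt ℂ (fun z : ℂ =>
      (C - (-z - 1 / 2) * riemannZeta (2 * (-z) + 1) / riemannZeta₁ (-z + 1 / 2)) / (-z)) t₀ :=
    (analyticAt_const.sub (((analyticAt_id.neg.sub analyticAt_const).mul ha₂).div ha₁ hz₁)).div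
      analyticAt_id.neg (neg_ne_zero.2 ht₀0)
  obtain ⟨t', ht', htI⟩ := exists_gt_mem_integrableExpSet Real.measurable_log.aemeasurable
    (log_nonneg_ae_powerMeasure _) hlt hf (by
      filter_upwards [ha₁.continuousAt.eventually_ne hz₁, eventually_ne_nhds ht₀0]
        with z hz1 hz0 hzre
      have := sub_mul_complexMGF_mul_riemannZeta₁ hC (σ := -t₀) (by linarith)
        (by rwa [neg_neg]) (s := -z) (by simpa using hzre)
      rw [neg_neg] at this
      rw [← this, mul_div_cancel_right₀ _ hz1, sub_sub_cancel,
        mul_div_cancel_left₀ _ (neg_ne_zero.2 hz0)]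
      rfl)
  obtain ⟨v, hv, hvt⟩ := exists_lt_of_csInf_lt hne ht'
  have hv1 : -1 ≤ v := not_lt.1 fun hv' => hv.2 (hone hv')
  -- The domain is convex, so it contains everything between -2 and `t'`, including the supposedly
  -- excluded `v`.
  have h2 : (-2 : ℝ) ∈ I := hone (by norm_num)
  exact hv.2 (convex_integrableExpSet.ordConnected.out h2 htI ⟨by linarith, hvt.le⟩)

/-- With `s = w - 1/2`, a zero would force `(s - 1/2) ζ(2s+1) = 0`; but `Re (2s+1) > 1`, and `s =
1/2` means `w = 1`, where `riemannZeta₁` is 1. -/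
theorem riemannZeta₁_ne_zero_of_half_lt_re (hC : ∀ t, 1 < t → 0 ≤ C - liouvilleSum t) {w : ℂ}
    (hw : 1 / 2 < w.re) : riemannZeta₁ w ≠ 0 := by
  rcases eq_or_ne w 1 with rfl | hw1
  · simp
  have hs : 0 < (w - 1 / 2).re := by simp; linarith
  have h := sub_mul_complexMGF_mul_riemannZeta₁ hC le_rfl (Iio_zero_subset_integrableExpSet hC) hs
  intro h0
  rw [sub_add_cancel, h0, mul_zero, eq_comm, mul_eq_zero] at h
  rcases h with h | h
  · apply hw1
    linear_combination h
  · refine riemannZeta_ne_zero_of_one_le_re ?_ h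
    simp only [Complex.add_re, Complex.mul_re, Complex.one_re, Complex.re_ofNat,
      Complex.im_ofNat, zero_mul, sub_zero]
    linarith

/-- The product identity at `s = 1/2` reads `C = (1/2) ∫ (C - S(t)) t^{-3/2} dt`, and the constant
`C` alone already contributes `C` to the right side. -/
theorem integrableOn_liouvilleSum_and_integral_eq_zero
    (hC : ∀ t, 1 < t → 0 ≤ C - liouvilleSum t) :
    IntegrableOn (fun t => liouvilleSum t * t ^ (-(3 / 2) : ℝ)) (Set.Ioi 1) ∧
      ∫ t in Set.Ioi (1 : ℝ), liouvilleSum t * t ^ (-(3 / 2) : ℝ) = 0 := by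
  have hI := Iio_zero_subset_integrableExpSet hC
  have e0 : (-(1 / 2 + 1) : ℝ) = -(3 / 2) := by norm_num
  have hi := (neg_mem_integrableExpSet_powerMeasure (measurable_const_sub_liouvilleSum C) hC
    (1 / 2)).1 (hI (by norm_num))
  rw [e0] at hi
  have hc : IntegrableOn (fun t : ℝ => C * t ^ (-(3 / 2) : ℝ)) (Set.Ioi 1) :=
    (integrableOn_Ioi_rpow_of_lt (by norm_num) zero_lt_one).const_mul C
  have hcv : ∫ t in Set.Ioi (1 : ℝ), C * t ^ (-(3 / 2) : ℝ) = 2 * C := by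
    rw [integral_const_mul, integral_Ioi_rpow_of_lt (by norm_num) zero_lt_one]
    norm_num
    ring
  have h := sub_mul_complexMGF_mul_riemannZeta₁ hC le_rfl hI (s := 1 / 2) (by norm_num)
  rw [sub_self, zero_mul, add_halves, riemannZeta₁_one, mul_one, liouvilleMeasure,
    complexMGF_log_powerMeasure (measurable_const_sub_liouvilleSum C) hC] at h
  have e1 : ∫ t in Set.Ioi (1 : ℝ), ((C - liouvilleSum t : ℝ) : ℂ) * (t : ℂ) ^ (-(1 / 2 + 1) : ℂ)
      = ((∫ t in Set.Ioi (1 : ℝ), (C - liouvilleSum t) * t ^ (-(3 / 2) : ℝ) : ℝ) : ℂ) := by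
    rw [← integral_complex_ofReal]
    refine setIntegral_congr_fun measurableSet_Ioi fun t ht => ?_
    have ht0 : 0 ≤ t := zero_le_one.trans (le_of_lt ht)
    rw [Complex.ofReal_mul, Complex.ofReal_cpow ht0]
    congr 2
    push_cast
    norm_num
  rw [e1] at h
  have h' : C - 1 / 2 * ∫ t in Set.Ioi (1 : ℝ), (C - liouvilleSum t) * t ^ (-(3 / 2) : ℝ) = 0 := by
    apply Complex.ofReal_injective
    push_cast at h ⊢
    exact h
  have hfun : (fun t => liouvilleSum t * t ^ (-(3 / 2) : ℝ))
      = fun t : ℝ => C * t ^ (-(3 / 2) : ℝ) - (C - liouvilleSum t) * t ^ (-(3 / 2) : ℝ) := by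
    ext t; ring
  rw [hfun]
  refine ⟨hc.sub hi, ?_⟩
  rw [integral_sub hc hi, hcv]
  linarith

theorem sum_liouville_div_eq {x : ℝ} (hx : 1 ≤ x) :
    ∑ n ∈ Finset.Icc 1 ⌊x⌋₊, (ArithmeticFunction.liouville n : ℝ) / n
      = x ^ (-(1 / 2) : ℝ) * liouvilleSum x
        + 1 / 2 * ∫ t in (1 : ℝ)..x, liouvilleSum t * t ^ (-(3 / 2) : ℝ) := by
  set c : ℕ → ℝ := fun n => (ArithmeticFunction.liouville n : ℝ) / (n : ℝ) ^ (1 / 2 : ℝ) with hc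
  have hc0 : c 0 = 0 := by simp [hc]
  -- The summation formula starts at index 0, where the term is zero because `c 0 = 0`.
  have hsum : ∀ (f : ℕ → ℝ) (N : ℕ), f 0 = 0 →
      ∑ k ∈ Finset.Icc 0 N, f k = ∑ k ∈ Finset.Icc 1 N, f k := fun f N h0 => by
    rw [Finset.Icc_eq_cons_Ioc N.zero_le, Finset.sum_cons, h0, zero_add]
    rfl
  have hder : ∀ t : ℝ, 0 < t →
      HasDerivAt (fun t : ℝ => t ^ (-(1 / 2) : ℝ)) (-(1 / 2) * t ^ (-(3 / 2) : ℝ)) t := by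
    intro t ht
    convert Real.hasDerivAt_rpow_const (p := -(1 / 2)) (Or.inl ht.ne') using 3
    norm_num
  have h := sum_mul_eq_sub_integral_mul₀ c hc0 x (f := fun t : ℝ => t ^ (-(1 / 2) : ℝ))
    (fun t ht => (hder t (zero_lt_one.trans_le ht.1)).differentiableAt) (by
      have h1 : ContinuousOn (fun t : ℝ => -(1 / 2) * t ^ (-(3 / 2) : ℝ)) (Set.Icc 1 x) :=
        continuousOn_const.mul (ContinuousOn.rpow_const continuousOn_id fun t ht =>
          Or.inl (zero_lt_one.trans_le ht.1).ne')
      exact h1.integrableOn_Icc.congr_fun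
        (fun t ht => (hder t (zero_lt_one.trans_le ht.1)).deriv.symm) measurableSet_Icc)
  rw [hsum _ _ (by simp [hc0]), hsum _ _ hc0] at h
  have e1 : ∑ n ∈ Finset.Icc 1 ⌊x⌋₊, (ArithmeticFunction.liouville n : ℝ) / n
      = ∑ n ∈ Finset.Icc 1 ⌊x⌋₊, (n : ℝ) ^ (-(1 / 2) : ℝ) * c n := by
    refine Finset.sum_congr rfl fun n hn => ?_
    have hn0 : (0 : ℝ) < n := by exact_mod_cast (Finset.mem_Icc.1 hn).1
    have e2 : (n : ℝ) ^ (-(1 / 2) : ℝ) / (n : ℝ) ^ (1 / 2 : ℝ) = (n : ℝ)⁻¹ := by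
      rw [← Real.rpow_sub hn0, ← Real.rpow_neg_one]; norm_num
    rw [hc, mul_div_left_comm, e2, div_eq_mul_inv]
  have e3 : ∫ t in Set.Ioc 1 x, deriv (fun t : ℝ => t ^ (-(1 / 2) : ℝ)) t
      * ∑ k ∈ Finset.Icc 0 ⌊t⌋₊, c k
      = -(1 / 2) * ∫ t in (1 : ℝ)..x, liouvilleSum t * t ^ (-(3 / 2) : ℝ) := by
    rw [intervalIntegral.integral_of_le hx, ← integral_const_mul]
    refine setIntegral_congr_fun measurableSet_Ioc fun t ht => ?_
    rw [(hder t (zero_lt_one.trans ht.1)).deriv, hsum _ _ hc0, liouvilleSum]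
    ring
  rw [e1, h, e3, liouvilleSum]
  ring

/-- If `∑_{n ≤ x} λ(n) n^{-1/2}` is bounded above, then `limsup ∑_{n ≤ x} λ(n)/n ≤ 0`. -/
theorem eventually_sum_liouville_div_le (hC : ∀ t, 1 < t → 0 ≤ C - liouvilleSum t) {ε : ℝ}
    (hε : 0 < ε) :
    ∀ᶠ x : ℝ in atTop,
      ∑ n ∈ Finset.Icc 1 ⌊x⌋₊, (ArithmeticFunction.liouville n : ℝ) / n ≤ ε := by
  obtain ⟨hi, hv⟩ := integrableOn_liouvilleSum_and_integral_eq_zero hC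
  have h1 := (intervalIntegral_tendsto_integral_Ioi 1 hi tendsto_id).const_mul (1 / 2)
  -- Only the upper bound `S(x) ≤ C` is available, so `x^{-1/2} S(x)` is compared with `x^{-1/2} C`,
  -- which tends to 0.
  have h2 := (tendsto_rpow_neg_atTop (y := 1 / 2) (by norm_num)).mul_const C
  have h3 := h2.add h1
  rw [hv, zero_mul, mul_zero, add_zero] at h3
  filter_upwards [h3.eventually_lt_const hε, eventually_gt_atTop 1] with x hx hx1
  rw [sum_liouville_div_eq hx1.le]
  have : x ^ (-(1 / 2) : ℝ) * liouvilleSum x ≤ x ^ (-(1 / 2) : ℝ) * C :=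
    mul_le_mul_of_nonneg_left (sub_nonneg.1 (hC x hx1)) (by positivity)
  simp only [id] at hx
  linarith

end UpperBound

/-! ### From the zero-free half-plane to the Riemann hypothesis -/

theorem analyticOnNhd_zetaRatio (h : ∀ w : ℂ, 1 / 2 < w.re → riemannZeta₁ w ≠ 0) :
    AnalyticOnNhd ℂ zetaRatio {s : ℂ | 1 / 2 < s.re} := by
  -- Rewriting the ratio over `riemannZeta₁` clears the pole and gives the value 0 at `s = 1`.
  have h1 : AnalyticOnNhd ℂ (fun s : ℂ => (s - 1) * riemannZeta (2 * s) / riemannZeta₁ s)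
      {s : ℂ | 1 / 2 < s.re} := fun z hz => by
    have hz1 : 2 * z ≠ 1 := by
      intro h
      have := congrArg Complex.re h
      simp at this
      simp at hz
      linarith
    have e1 : AnalyticAt ℂ (fun s : ℂ => riemannZeta (2 * s)) z :=
      (analyticAt_riemannZeta hz1).comp_of_eq (by fun_prop) rfl
    exact ((analyticAt_id.sub analyticAt_const).mul e1).div
      (differentiable_riemannZeta₁.analyticAt z) (h z hz)
  refine h1.congr (isOpen_halfPlane _) fun s _ => ?_
  rcases eq_or_ne s 1 with rfl | hs1
  · simp [zetaRatio]
  · rw [zetaRatio, Function.update_of_ne hs1, riemannZeta₁_eq_mul hs1,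
      mul_div_mul_left _ _ (sub_ne_zero.2 hs1)]

theorem riemannHypothesis_of_zeta_ne_zero (h : ∀ w : ℂ, 1 / 2 < w.re → riemannZeta₁ w ≠ 0) :
    RiemannHypothesis := by
  have hright : ∀ w : ℂ, 1 / 2 < w.re → w ≠ 1 → riemannZeta w ≠ 0 := fun w hw hw1 h0 =>
    h w hw (by rw [riemannZeta₁_eq_mul hw1, h0, mul_zero])
  intro s hs htriv hs1
  have hs0 : s ≠ 0 := by
    rintro rfl
    rw [riemannZeta_zero] at hs
    norm_num at hs
  rcases lt_trichotomy s.re (1 / 2) with hlt | heq | hgt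
  · exfalso
    -- `Gammaℝ` takes the default value 0 at its poles `-2n`; these are 0 and the trivial zeros.
    -- Away from them, a zero of `ζ` is a zero of the completed function and reflects to `1 - s`.
    have hG : Complex.Gammaℝ s ≠ 0 := by
      rw [Ne, Complex.Gammaℝ_eq_zero_iff]
      rintro ⟨n, hn⟩
      rcases n with _ | n
      · simp at hn; exact hs0 hn
      · exact htriv ⟨n, by rw [hn]; push_cast; ring⟩
    have hΛ : completedRiemannZeta s = 0 := by
      rw [riemannZeta_def_of_ne_zero hs0, div_eq_zero_iff] at hs
      exact hs.resolve_right hG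
    have h1s : (1 - s) ≠ 0 := sub_ne_zero.2 hs1.symm
    refine hright (1 - s) (by simp; linarith) (by simpa using hs0) ?_
    rw [riemannZeta_def_of_ne_zero h1s, completedRiemannZeta_one_sub, hΛ, zero_div]
  · exact heq
  · exact absurd hs (hright s hgt hs1)

theorem theorem2 (ξ : ℕ → ℝ) (hξ : IsMeanValueSeq (1 / 2) 1 ξ)
    (hL : ∃ r : ℝ, 0 < r ∧ ∀ᶠ x : ℝ in Filter.atTop, partialL ξ x ≤ 1 - r) :
    (∀ᶠ x : ℝ in Filter.atTop, partialF x (1 / 2) ≤ 0) ∧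
    AnalyticOnNhd ℂ zetaRatio {s : ℂ | 1 / 2 < s.re} ∧
    RiemannHypothesis := by
  obtain ⟨r, hr, hLr⟩ := hL
  have hF1 : ∀ x : ℝ, 1 ≤ x → partialF x 1
      = ∑ n ∈ Finset.Icc 1 ⌊x⌋₊, (ArithmeticFunction.liouville n : ℝ) / n - 1 := fun x hx => by
    rw [partialF_eq hx]
    simp only [Real.rpow_one]
  obtain ⟨X, hX⟩ := eventually_atTop.1 hLr
  -- For `t ≥ X`, `S(t) = ∑ λ(n)/n + L_t(ξ) ≤ 2 + (1 - r) < 3`; for `t < X` the trivial bound `S(t)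
  -- ≤ t` suffices.
  have hC : ∀ t : ℝ, 1 < t → 0 ≤ max 3 X - liouvilleSum t := by
    intro t ht
    rw [sub_nonneg]
    rcases lt_or_ge t X with h | h
    · exact ((le_abs_self _).trans (abs_liouvilleSum_le (zero_le_one.trans ht.le))).trans
        (h.le.trans (le_max_right _ _))
    · refine le_trans ?_ (le_max_left _ _)
      have h1 := partialF_half_eq_add_partialL hξ t
      have h2 : partialF t (1 / 2) = liouvilleSum t - 1 := partialF_eq ht.le _
      have h3 := sum_liouville_div_le_two ⌊t⌋₊
      have h4 := hF1 t ht.le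
      have h5 := hX t h
      linarith
  have hne : ∀ w : ℂ, 1 / 2 < w.re → riemannZeta₁ w ≠ 0 := fun w hw =>
    riemannZeta₁_ne_zero_of_half_lt_re hC hw
  refine ⟨?_, analyticOnNhd_zetaRatio hne, riemannHypothesis_of_zeta_ne_zero hne⟩
  -- The choice `ε = r` balances exactly: `F_x(1/2) ≤ (r - 1) + (1 - r) = 0`.
  filter_upwards [hLr, eventually_sum_liouville_div_le hC hr, eventually_ge_atTop 1]
    with x hx1 hx2 hx3
  rw [partialF_half_eq_add_partialL hξ, hF1 x hx3]
  linarith
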